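/- Let $\log$ denote the base-2 logarithm. A binary tree is a finite rooted tree in which every vertex has at most one left child and at most one right child; its size is its number of vertices. A (planar, straight-line) drawing of a tree in a $W\times H$ grid maps the vertices to distinct points of $\{1,\dots,W\}\times\{1,\dots,H\}$ and draws each edge as the straight line segment between its endpoints, in such a way that no edge passes through a vertex other than its endpoints and no two distinct edges meet except at a common endpoint; its area is $W\cdot H$. The drawing is orthogonal if every edge is drawn as a horizontal or vertical segment. It is order-preserving if around every vertex $v$ that has a parent, a left child and a right child, the parent, the left child and the right child of $v$ appear in this counterclockwise order. Theorem. There is a constant $C>0$ such that for every integer $n\ge 2$, every binary tree of size $n$ has a planar straight-line drawing that is both orthogonal and order-preserving and has area at most $$C\, n\, 2^{\sqrt{2\log n}}\,\sqrt{\log n}.$$ -/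

import Mathlib

namespace TreeDrawing

/-- The vertices of a rooted ordered binary tree are addressed by the turns on the path from the
root: `[]` is the root, and the left (right) child of `p` is `p ++ [false]` (`p ++ [true]`).
`IsVertex T p` says that the address `p` is a vertex of `T`. -/
def IsVertex : BinaryTree Unit → List Bool → Prop
  | .nil, _ => False
  | .node _ _ _, [] => True
  | .node _ l _, false :: p => IsVertex l p
  | .node _ _ r, true :: p => IsVertex r p

/-- `IsEdge T p q`: `p` and `q` are vertices of `T` and `q` is the left or right child of `p`. -/
def IsEdge (T : BinaryTree Unit) (p q : List Bool) : Prop :=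
  IsVertex T p ∧ IsVertex T q ∧ ∃ b : Bool, q = p ++ [b]

/-- The point of the plane given by a point of the integer grid. -/
def toPlane (z : ℤ × ℤ) : ℝ × ℝ := ((z.1 : ℝ), (z.2 : ℝ))

/-- The edge between vertices placed at `a` and `b`, without its endpoints (for `a ≠ b`). -/
def openEdge (a b : ℤ × ℤ) : Set (ℝ × ℝ) := openSegment ℝ (toPlane a) (toPlane b)

/-- `pos` places the vertices of `T` at grid points so that the straight-line drawing is planar:
distinct vertices are at distinct points, no edge passes through a vertex, and
distinct edges do not cross or overlap. Values of `pos` outside of `T` are irrelevant. -/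
structure IsPlanar (T : BinaryTree Unit) (pos : List Bool → ℤ × ℤ) : Prop where
  injOn : Set.InjOn pos {p | IsVertex T p}
  vertex_notMem : ∀ p q v, IsEdge T p q → IsVertex T v →
    toPlane (pos v) ∉ openEdge (pos p) (pos q)
  disjoint : ∀ p q p' q', IsEdge T p q → IsEdge T p' q' → (p, q) ≠ (p', q') →
    Disjoint (openEdge (pos p) (pos q)) (openEdge (pos p') (pos q'))

/-- Every edge is drawn as a vertical or a horizontal segment. -/
def IsOrthogonal (T : BinaryTree Unit) (pos : List Bool → ℤ × ℤ) : Prop :=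
  ∀ p q, IsEdge T p q → (pos p).1 = (pos q).1 ∨ (pos p).2 = (pos q).2

/-- `a` lies in the direction of angle `θ` as seen from the point `o`. -/
def HasDirection (o a : ℤ × ℤ) (θ : ℝ) : Prop :=
  ∃ r : ℝ, 0 < r ∧ toPlane a = toPlane o + (r * Real.cos θ, r * Real.sin θ)

/-- `a`, `b`, `c` appear in this (strict) counterclockwise order around `o`. -/
def IsCounterclockwise (o a b c : ℤ × ℤ) : Prop :=
  ∃ α β γ : ℝ, α < β ∧ β < γ ∧ γ < α + 2 * Real.pi ∧
    HasDirection o a α ∧ HasDirection o b β ∧ HasDirection o c γ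

/-- Around each vertex `v` that has a parent, a left child and a right child, these three appear
in counterclockwise order. (At all other vertices there is no condition: any cyclic order of
at most two neighbours is the same.) -/
def IsOrderPreserving (T : BinaryTree Unit) (pos : List Bool → ℤ × ℤ) : Prop :=
  ∀ u v, IsEdge T u v → IsVertex T (v ++ [false]) → IsVertex T (v ++ [true]) →
    IsCounterclockwise (pos v) (pos u) (pos (v ++ [false])) (pos (v ++ [true]))

/-- All vertices of `T` are placed in the grid `{1, …, W} × {1, …, H}`. -/
def InGrid (T : BinaryTree Unit) (pos : List Bool → ℤ × ℤ) (W H : ℕ) : Prop :=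
  ∀ p, IsVertex T p → pos p ∈ Set.Icc (1 : ℤ) W ×ˢ Set.Icc (1 : ℤ) H

end TreeDrawing

/-! The height is kept equal to the number `n` of vertices, so only the width has to be bounded. If
`m` vertices fit into width `v` and `q ≥ m` vertices into width `w ≥ 2 * v`, then `q + m` vertices
fit into width `w + 2` (`sideDrawable_step`).

In a tree with at most `q + m` vertices, a subtree with more than `q` vertices has a sibling with
fewer than `m`. Up to reflection the right subtree of the root has at most `q` vertices. If all
right subtrees along the left spine have at most `q` vertices, a straight spine with these subtrees
beside it needs width `w + 1`. Otherwise the path of subtrees with more than `q` vertices runs down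
column `v`, with the small siblings in the `v` columns on either side. At its last right turn it
moves out to column `w + 1`, and the two remaining subtrees spread over the full width, one below
everything else and one above. The inequality `2 * v ≤ w` keeps column `w + 1` free for the edge
leading up.

With `m` fixed, adding `m` vertices costs two columns, so multiplying the size by `2 ^ (k + 1)`
takes the width from `v` to less than `2 * v + 2 ^ (k + 2)`. Hence size `2 ^ (k * (k + 1) / 2)`
needs width at most `2 ^ k * (2 * k + 1)`, and `k = ⌈√(2 log n)⌉` gives the theorem.

Drawings are built as disjoint sets of lattice points (`Attachable`); `Layout.isPlanar` and
`Layout.isOrderPreserving` turn them into real drawings. -/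

namespace TreeDrawing

/-! ### Lattice drawings and their symmetries. -/

/-- If a vertex is entered in direction `(dx, dy)`, its left child lies in direction `(lx, ly)` and
its right child in direction `(rx, ry)`, then parent, left child, right child are in
counterclockwise order. -/
def Turn (dx dy lx ly rx ry : ℤ) : Prop :=
  (lx = dy ∧ ly = -dx ∧ rx = dx ∧ ry = dy) ∨
  (lx = dy ∧ ly = -dx ∧ rx = -dy ∧ ry = dx) ∨
  (lx = dx ∧ ly = dy ∧ rx = -dy ∧ ry = dx)

/-- `Attachable T x y dx dy S`: the tree `T` can be drawn with the parent of its root at `(x, y)`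
and its root in direction `(dx, dy)` from there, such that the drawing, including the edge from
`(x, y)` to the root without its starting point, only uses grid points of `S`. -/
def Attachable : BinaryTree Unit → ℤ → ℤ → ℤ → ℤ → (ℤ → ℤ → Prop) → Prop
  | .nil, _, _, _, _, _ => True
  | .node _ l r, x, y, dx, dy, S => ∃ (k lx ly rx ry : ℤ) (L R : ℤ → ℤ → Prop),
      1 ≤ k ∧ Turn dx dy lx ly rx ry ∧
      (∀ j, 1 ≤ j → j ≤ k → S (x + j * dx) (y + j * dy) ∧
        ¬ L (x + j * dx) (y + j * dy) ∧ ¬ R (x + j * dx) (y + j * dy)) ∧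
      (∀ a b, L a b → S a b) ∧ (∀ a b, R a b → S a b) ∧ (∀ a b, L a b → ¬ R a b) ∧
      Attachable l (x + k * dx) (y + k * dy) lx ly L ∧
      Attachable r (x + k * dx) (y + k * dy) rx ry R

/-- The grid points of the rectangle `[x₀, x₁) × [y₀, y₁)`. -/
def Box (x₀ x₁ y₀ y₁ : ℤ) (a b : ℤ) : Prop := x₀ ≤ a ∧ a < x₁ ∧ y₀ ≤ b ∧ b < y₁

theorem Attachable.mono {T : BinaryTree Unit} {x y dx dy : ℤ} {S S' : ℤ → ℤ → Prop}
    (h : Attachable T x y dx dy S) (hS : ∀ a b, S a b → S' a b) : Attachable T x y dx dy S' := by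
  cases T with
  | nil => trivial
  | node u l r =>
    obtain ⟨k, lx, ly, rx, ry, L, R, hk, ht, hs, hL, hR, hLR, hl, hr⟩ := h
    exact ⟨k, lx, ly, rx, ry, L, R, hk, ht, fun j h1 h2 => ⟨hS _ _ (hs j h1 h2).1, (hs j h1 h2).2⟩,
      fun a b h => hS _ _ (hL a b h), fun a b h => hS _ _ (hR a b h), hLR, hl, hr⟩

theorem Attachable.node {u : Unit} {l r : BinaryTree Unit} {x y dx dy x' y' lx ly rx ry : ℤ}
    {S L R : ℤ → ℤ → Prop} (hl : Attachable l x' y' lx ly L) (hr : Attachable r x' y' rx ry R)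
    (k : ℤ) (hk : 1 ≤ k) (hx : x' = x + k * dx) (hy : y' = y + k * dy)
    (ht : Turn dx dy lx ly rx ry)
    (hs : ∀ j, 1 ≤ j → j ≤ k → S (x + j * dx) (y + j * dy) ∧
      ¬ L (x + j * dx) (y + j * dy) ∧ ¬ R (x + j * dx) (y + j * dy))
    (hL : ∀ a b, L a b → S a b) (hR : ∀ a b, R a b → S a b) (hLR : ∀ a b, L a b → ¬ R a b) :
    Attachable (.node u l r) x y dx dy S := by
  subst hx hy
  exact ⟨k, lx, ly, rx, ry, L, R, hk, ht, hs, hL, hR, hLR, hl, hr⟩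

/-- The edge to the root may be extended backwards. -/
theorem Attachable.extend {T : BinaryTree Unit} {x y dx dy : ℤ} {S S' : ℤ → ℤ → Prop}
    (h : Attachable T x y dx dy S) (x' y' j : ℤ) (hj : 0 ≤ j) (hx : x = x' + j * dx)
    (hy : y = y' + j * dy) (hS : ∀ a b, S a b → S' a b)
    (hseg : ∀ i, 1 ≤ i → i ≤ j → S' (x' + i * dx) (y' + i * dy) ∧
      ¬ S (x' + i * dx) (y' + i * dy)) :
    Attachable T x' y' dx dy S' := by
  cases T with
  | nil => trivial
  | node u l r =>
    obtain ⟨k, lx, ly, rx, ry, L, R, hk, ht, hs, hL, hR, hLR, hl, hr⟩ := h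
    refine ⟨k + j, lx, ly, rx, ry, L, R, by omega, ht, fun i h1 h2 => ?_,
      fun a b h => hS _ _ (hL a b h), fun a b h => hS _ _ (hR a b h), hLR, ?_, ?_⟩
    · rcases le_or_gt i j with hij | hij
      · have := hseg i h1 hij
        exact ⟨this.1, fun h => this.2 (hL _ _ h), fun h => this.2 (hR _ _ h)⟩
      · have := hs (i - j) (by omega) (by omega)
        rw [show x + (i - j) * dx = x' + i * dx by rw [hx]; ring,
          show y + (i - j) * dy = y' + i * dy by rw [hy]; ring] at this
        exact ⟨hS _ _ this.1, this.2⟩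
    · rw [show x' + (k + j) * dx = x + k * dx by rw [hx]; ring,
        show y' + (k + j) * dy = y + k * dy by rw [hy]; ring]
      exact hl
    · rw [show x' + (k + j) * dx = x + k * dx by rw [hx]; ring,
        show y' + (k + j) * dy = y + k * dy by rw [hy]; ring]
      exact hr

theorem Attachable.translate {T : BinaryTree Unit} {x y dx dy : ℤ} {S : ℤ → ℤ → Prop}
    (h : Attachable T x y dx dy S) (a b : ℤ) :
    Attachable T (x + a) (y + b) dx dy (fun u v => S (u - a) (v - b)) := by
  induction T generalizing x y dx dy S with
  | nil => trivial
  | node u l r ihl ihr =>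
    obtain ⟨k, lx, ly, rx, ry, L, R, hk, ht, hs, hL, hR, hLR, hl, hr⟩ := h
    refine ⟨k, lx, ly, rx, ry, fun u v => L (u - a) (v - b), fun u v => R (u - a) (v - b), hk, ht,
      fun j h1 h2 => ?_, fun a b h => hL _ _ h, fun a b h => hR _ _ h, fun a b h => hLR _ _ h,
      ?_, ?_⟩
    · have := hs j h1 h2
      dsimp only
      rwa [show x + a + j * dx - a = x + j * dx by ring,
        show y + b + j * dy - b = y + j * dy by ring]
    · have := ihl hl
      rwa [add_right_comm x, add_right_comm y] at this
    · have := ihr hr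
      rwa [add_right_comm x, add_right_comm y] at this

/-- Rotation by a half turn. -/
theorem Attachable.rotate {T : BinaryTree Unit} {x y dx dy : ℤ} {S : ℤ → ℤ → Prop}
    (h : Attachable T x y dx dy S) :
    Attachable T (-x) (-y) (-dx) (-dy) (fun u v => S (-u) (-v)) := by
  induction T generalizing x y dx dy S with
  | nil => trivial
  | node u l r ihl ihr =>
    obtain ⟨k, lx, ly, rx, ry, L, R, hk, ht, hs, hL, hR, hLR, hl, hr⟩ := h
    refine ⟨k, -lx, -ly, -rx, -ry, fun u v => L (-u) (-v), fun u v => R (-u) (-v), hk, ?_,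
      fun j h1 h2 => ?_, fun a b h => hL _ _ h, fun a b h => hR _ _ h, fun a b h => hLR _ _ h,
      ?_, ?_⟩
    · unfold Turn at *; omega
    · have := hs j h1 h2
      dsimp only
      rwa [show -(-x + j * -dx) = x + j * dx by ring,
        show -(-y + j * -dy) = y + j * dy by ring]
    · have := ihl hl
      rwa [show -(x + k * dx) = -x + k * -dx by ring,
        show -(y + k * dy) = -y + k * -dy by ring] at this
    · have := ihr hr
      rwa [show -(x + k * dx) = -x + k * -dx by ring,
        show -(y + k * dy) = -y + k * -dy by ring] at this

/-- The mirror image of a binary tree. -/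
def mirror : BinaryTree Unit → BinaryTree Unit
  | .nil => .nil
  | .node a l r => .node a (mirror r) (mirror l)

theorem mirror_mirror (T : BinaryTree Unit) : mirror (mirror T) = T := by
  induction T with
  | nil => rfl
  | node a l r ihl ihr => simp [mirror, ihl, ihr]

theorem numNodes_mirror (T : BinaryTree Unit) : (mirror T).numNodes = T.numNodes := by
  induction T with
  | nil => rfl
  | node a l r ihl ihr => simp [mirror, ihl, ihr]; omega

/-- Reflection in a horizontal line. -/
theorem Attachable.reflect {T : BinaryTree Unit} {x y dx dy : ℤ} {S : ℤ → ℤ → Prop}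
    (h : Attachable T x y dx dy S) :
    Attachable (mirror T) x (-y) dx (-dy) (fun u v => S u (-v)) := by
  induction T generalizing x y dx dy S with
  | nil => trivial
  | node u l r ihl ihr =>
    obtain ⟨k, lx, ly, rx, ry, L, R, hk, ht, hs, hL, hR, hLR, hl, hr⟩ := h
    refine ⟨k, rx, -ry, lx, -ly, fun u v => R u (-v), fun u v => L u (-v), hk, ?_,
      fun j h1 h2 => ?_, fun a b h => hR _ _ h, fun a b h => hL _ _ h,
      fun a b h h' => hLR _ _ h' h, ?_, ?_⟩
    · unfold Turn at *; omega
    · have := hs j h1 h2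
      dsimp only
      rw [show -(-y + j * -dy) = y + j * dy by ring]
      exact ⟨this.1, this.2.2, this.2.1⟩
    · have := ihr hr
      rwa [show -(y + k * dy) = -y + k * -dy by ring] at this
    · have := ihl hl
      rwa [show -(y + k * dy) = -y + k * -dy by ring] at this

/-! ### Side drawings and subtrees stacked along a straight spine. -/

/-- `T` has a drawing in a `w × h` rectangle whose root is visible from the left. -/
def SideDrawable (T : BinaryTree Unit) (w h : ℤ) : Prop :=
  ∃ y, Attachable T (-1) y 1 0 (Box 0 w 0 h)

theorem SideDrawable.mono {T : BinaryTree Unit} {w h w' h' : ℤ} (H : SideDrawable T w h)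
    (hw : w ≤ w') (hh : h ≤ h') : SideDrawable T w' h' := by
  obtain ⟨y, H⟩ := H
  exact ⟨y, H.mono fun a b => by unfold Box; omega⟩

theorem SideDrawable.of_mirror {T : BinaryTree Unit} {w h : ℤ} (H : SideDrawable (mirror T) w h) :
    SideDrawable T w h := by
  obtain ⟨y, H⟩ := H
  have := H.reflect.translate 0 (h - 1)
  rw [mirror_mirror] at this
  exact ⟨_, Attachable.mono (by simpa using this) fun a b => by unfold Box; omega⟩

/-- The non-strict bound `y ≤ y₀ + h` lets the empty tree, with `h = 0`, be placed without a case
distinction by the callers. -/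
theorem SideDrawable.place_right {T : BinaryTree Unit} {w h : ℤ} (H : SideDrawable T w h)
    (hh : 0 ≤ h) (x₀ y₀ : ℤ) : ∃ y, y₀ ≤ y ∧ y ≤ y₀ + h ∧
      Attachable T (x₀ - 1) y 1 0 (Box x₀ (x₀ + w) y₀ (y₀ + h)) := by
  obtain ⟨y, H⟩ := H
  cases T with
  | nil => exact ⟨y₀, by omega, by omega, trivial⟩
  | node u l r =>
    have hy : 0 ≤ y ∧ y < h := by
      obtain ⟨k, lx, ly, rx, ry, L, R, hk, ht, hs, -⟩ := H
      have := (hs 1 le_rfl hk).1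
      unfold Box at this; omega
    refine ⟨y + y₀, by omega, by omega, ?_⟩
    have := H.translate x₀ y₀
    rw [show -1 + x₀ = x₀ - 1 by ring] at this
    exact this.mono fun a b => by unfold Box; omega

/-- A half turn is used because a reflection in a vertical line would reverse the order of the
children. -/
theorem SideDrawable.place_left {T : BinaryTree Unit} {w h : ℤ} (H : SideDrawable T w h)
    (hh : 0 ≤ h) (x₀ y₀ : ℤ) : ∃ y, y₀ ≤ y ∧ y ≤ y₀ + h ∧
      Attachable T (x₀ + w) y (-1) 0 (Box x₀ (x₀ + w) y₀ (y₀ + h)) := by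
  obtain ⟨y, h1, h2, H⟩ := H.place_right hh 0 0
  cases T with
  | nil => exact ⟨y₀, by omega, by omega, trivial⟩
  | node u l r =>
    have hy : y < h := by
      obtain ⟨k, lx, ly, rx, ry, L, R, hk, ht, hs, -⟩ := H
      have := (hs 1 le_rfl hk).1
      unfold Box at this; omega
    refine ⟨-y + (y₀ + h - 1), by omega, by omega, ?_⟩
    have := H.rotate.translate (x₀ + w - 1) (y₀ + h - 1)
    rw [show -(0 - 1) + (x₀ + w - 1) = x₀ + w by ring, neg_zero] at this
    exact this.mono fun a b => by unfold Box; omega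

/-- All left subtrees hanging off the right spine of `T` are `SideDrawable` of width `w`. -/
def RightSpine (w : ℤ) : BinaryTree Unit → Prop
  | .nil => True
  | .node _ l r => SideDrawable l w l.numNodes ∧ RightSpine w r

/-- All right subtrees hanging off the left spine of `T` are `SideDrawable` of width `w`. -/
def LeftSpine (w : ℤ) : BinaryTree Unit → Prop
  | .nil => True
  | .node _ l r => SideDrawable r w r.numNodes ∧ LeftSpine w l

/-- The right spine runs straight down the last column. The left subtrees lie to its left in
consecutive horizontal strips, and each spine vertex takes the row in which its left subtree is
entered. -/
theorem RightSpine.attachable {T : BinaryTree Unit} {w : ℤ} (H : RightSpine w T) (hw : 0 ≤ w)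
    (x₀ y₀ : ℤ) : Attachable T (x₀ + w) (y₀ + T.numNodes) 0 (-1)
      (Box x₀ (x₀ + w + 1) y₀ (y₀ + T.numNodes)) := by
  induction T with
  | nil => trivial
  | node u l r _ ihr =>
    obtain ⟨y, hy1, hy2, hl⟩ := H.1.place_left (by positivity) x₀ (y₀ + r.numNodes)
    have hr := ihr H.2
    simp only [BinaryTree.numNodes, Nat.cast_add, Nat.cast_one] at *
    have hr' : Attachable r (x₀ + w) y 0 (-1)
        (fun a b => Box x₀ (x₀ + w + 1) y₀ (y₀ + r.numNodes) a b ∨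
          (a = x₀ + w ∧ y₀ + r.numNodes ≤ b ∧ b < y)) :=
      hr.extend _ _ (y - (y₀ + r.numNodes)) (by omega) (by ring) (by ring) (fun a b h => .inl h)
        fun i h1 h2 => by unfold Box; omega
    refine .node hl hr' (y₀ + (l.numNodes + r.numNodes + 1) - y) (by omega) (by ring) (by ring)
      (by unfold Turn; omega) (fun j h1 h2 => ?_) (fun a b => ?_) (fun a b => ?_)
      (fun a b => ?_) <;> unfold Box <;> omega

theorem LeftSpine.attachable {T : BinaryTree Unit} {w : ℤ} (H : LeftSpine w T) (hw : 0 ≤ w)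
    (x₀ y₀ : ℤ) : Attachable T (x₀ + w) (y₀ - 1) 0 1
      (Box x₀ (x₀ + w + 1) y₀ (y₀ + T.numNodes)) := by
  induction T generalizing y₀ with
  | nil => trivial
  | node u l r ihl _ =>
    obtain ⟨y, hy1, hy2, hr⟩ := H.1.place_left (by positivity) x₀ y₀
    have hl := ihl H.2 (y₀ + r.numNodes + 1)
    simp only [BinaryTree.numNodes, Nat.cast_add, Nat.cast_one] at *
    have hl' : Attachable l (x₀ + w) y 0 1
        (fun a b => Box x₀ (x₀ + w + 1) (y₀ + r.numNodes + 1) (y₀ + r.numNodes + 1 + l.numNodes) a b ∨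
          (a = x₀ + w ∧ y < b ∧ b < y₀ + r.numNodes + 1)) :=
      hl.extend _ _ (y₀ + r.numNodes - y) (by omega) (by ring) (by ring) (fun a b h => .inl h)
        fun i h1 h2 => by unfold Box; omega
    refine .node hl' hr (y - (y₀ - 1)) (by omega) (by ring) (by ring)
      (by unfold Turn; omega) (fun j h1 h2 => ?_) (fun a b => ?_) (fun a b => ?_)
      (fun a b => ?_) <;> unfold Box <;> omega

/-- Entered from the right, the root sends its left spine up the last column and its right subtree
straight on; a half turn then makes the root visible from the left. -/
theorem LeftSpine.sideDrawable {T : BinaryTree Unit} {w : ℤ} (H : LeftSpine w T) (hw : 0 ≤ w) :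
    SideDrawable T (w + 1) T.numNodes := by
  cases T with
  | nil => exact ⟨0, trivial⟩
  | node u l r =>
    obtain ⟨y, hy1, hy2, hr⟩ := H.1.place_left (by positivity) 0 0
    have hl := H.2.attachable hw 0 (r.numNodes + 1)
    simp only [zero_add] at hl hr hy2
    have hl' : Attachable l w y 0 1
        (fun a b => Box 0 (w + 1) (r.numNodes + 1) (r.numNodes + 1 + l.numNodes) a b ∨
          (a = w ∧ y < b ∧ b < r.numNodes + 1)) :=
      hl.extend _ _ (r.numNodes - y) (by omega) (by ring) (by ring) (fun a b h => .inl h)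
        fun i h1 h2 => by unfold Box; omega
    have : Attachable (.node u l r) (w + 1) y (-1) 0
        (Box 0 (w + 1) 0 (l.numNodes + r.numNodes + 1)) := by
      refine .node hl' hr 1 (by omega) (by ring) (by ring)
        (by unfold Turn; omega) (fun j h1 h2 => ?_) (fun a b => ?_) (fun a b => ?_)
        (fun a b => ?_) <;> unfold Box <;> omega
    refine ⟨-y + (l.numNodes + r.numNodes), ?_⟩
    have := this.rotate.translate w (l.numNodes + r.numNodes)
    rw [show -(w + 1) + w = -1 by ring, neg_zero, neg_neg] at this
    exact this.mono fun a b => by simp only [BinaryTree.numNodes, Nat.cast_add, Nat.cast_one]; unfold Box; omega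

/-! ### The chain of large subtrees and the recursion step. -/

/-- All right subtrees hanging off the left spine of `T` have at most `q` vertices. -/
def PureLeft (q : ℕ) : BinaryTree Unit → Prop
  | .nil => True
  | .node _ l r => r.numNodes ≤ q ∧ PureLeft q l

theorem PureLeft.of_numNodes_le {q : ℕ} {T : BinaryTree Unit} (h : T.numNodes ≤ q) :
    PureLeft q T := by
  induction T with
  | nil => trivial
  | node u l r ihl _ =>
    simp only [BinaryTree.numNodes] at h
    exact ⟨by omega, ihl (by omega)⟩

theorem PureLeft.leftSpine {q : ℕ} {w : ℤ} {T : BinaryTree Unit} (h : PureLeft q T)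
    (H : ∀ T : BinaryTree Unit, T.numNodes ≤ q → SideDrawable T w T.numNodes) :
    LeftSpine w T := by
  induction T with
  | nil => trivial
  | node u l r ihl _ => exact ⟨H r h.1, ihl h.2⟩

theorem rightSpine_of_numNodes_le {q : ℕ} {w : ℤ} {T : BinaryTree Unit} (h : T.numNodes ≤ q)
    (H : ∀ T : BinaryTree Unit, T.numNodes ≤ q → SideDrawable T w T.numNodes) :
    RightSpine w T := by
  induction T with
  | nil => trivial
  | node u l r _ ihr =>
    simp only [BinaryTree.numNodes] at h
    exact ⟨H l (by omega), ihr (by omega)⟩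

/-- The grid points used by a drawing that hangs down in the columns `[0, w + 1]` from the row
`y₀` to the row `y₀ - h`, and that continues upwards in column `w + 1` to a rectangle of height
`h'` above the row `y`. -/
def ChainRegion (w y₀ h y h' : ℤ) (a b : ℤ) : Prop :=
  Box 0 (w + 2) (y₀ - h) y₀ a b ∨ (a = w + 1 ∧ y₀ ≤ b ∧ b < y) ∨ Box 0 (w + 2) y (y + h') a b

/-- `T` can be drawn hanging down from column `v`, in a region of the form `ChainRegion`. -/
def ChainDrawable (v w : ℤ) (T : BinaryTree Unit) : Prop :=
  ∃ h h' : ℤ, 0 ≤ h ∧ 0 ≤ h' ∧ h + h' ≤ T.numNodes ∧ ∀ y₀ y, y₀ ≤ y →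
    Attachable T v y₀ 0 (-1) (ChainRegion w y₀ h y h')

/-- The small left subtree fills columns `0` to `v - 1` of a new strip above the chain; `cons_left`
uses columns `v + 1` to `2 * v` instead. Both avoid column `w + 1`, where the end of the chain
passes upwards. -/
theorem ChainDrawable.cons_right {v w : ℤ} {u : Unit} {l r : BinaryTree Unit} (hv : 0 ≤ v)
    (hvw : 2 * v ≤ w) (hl : SideDrawable l v l.numNodes) (hr : ChainDrawable v w r) :
    ChainDrawable v w (.node u l r) := by
  obtain ⟨h, h', h0, h0', hh, H⟩ := hr
  refine ⟨h + l.numNodes + 1, h', by omega, h0', by simp; omega, fun y₀ y hy => ?_⟩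
  obtain ⟨b, hb1, hb2, Hl⟩ := hl.place_left (by positivity) 0 (y₀ - l.numNodes - 1)
  rw [zero_add] at Hl
  have Hr : Attachable r v b 0 (-1) (fun a c => ChainRegion w (y₀ - l.numNodes - 1) h y h' a c ∨
      (a = v ∧ y₀ - l.numNodes - 1 ≤ c ∧ c < b)) :=
    (H (y₀ - l.numNodes - 1) y (by omega)).extend _ _ (b - (y₀ - l.numNodes - 1)) (by omega)
      (by ring) (by ring) (fun a c h => .inl h)
      fun i h1 h2 => by unfold ChainRegion Box; omega
  refine .node Hl Hr (y₀ - b) (by omega) (by ring) (by ring) (by unfold Turn; omega)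
    (fun j h1 h2 => ?_) (fun a b => ?_) (fun a b => ?_) (fun a b => ?_) <;>
    simp only [ChainRegion, Box] <;> omega

theorem ChainDrawable.cons_left {v w : ℤ} {u : Unit} {l r : BinaryTree Unit} (hv : 0 ≤ v)
    (hvw : 2 * v ≤ w) (hl : ChainDrawable v w l) (hr : SideDrawable r v r.numNodes) :
    ChainDrawable v w (.node u l r) := by
  obtain ⟨h, h', h0, h0', hh, H⟩ := hl
  refine ⟨h + r.numNodes + 1, h', by omega, h0', by simp; omega, fun y₀ y hy => ?_⟩
  obtain ⟨b, hb1, hb2, Hr⟩ := hr.place_right (by positivity) (v + 1) (y₀ - r.numNodes - 1)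
  rw [add_sub_cancel_right] at Hr
  have Hl : Attachable l v b 0 (-1) (fun a c => ChainRegion w (y₀ - r.numNodes - 1) h y h' a c ∨
      (a = v ∧ y₀ - r.numNodes - 1 ≤ c ∧ c < b)) :=
    (H (y₀ - r.numNodes - 1) y (by omega)).extend _ _ (b - (y₀ - r.numNodes - 1)) (by omega)
      (by ring) (by ring) (fun a c h => .inl h)
      fun i h1 h2 => by unfold ChainRegion Box; omega
  refine .node Hl Hr (y₀ - b) (by omega) (by ring) (by ring) (by unfold Turn; omega)
    (fun j h1 h2 => ?_) (fun a b => ?_) (fun a b => ?_) (fun a b => ?_) <;>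
    simp only [ChainRegion, Box] <;> omega

/-- A chain may end by leading the right subtree to the rightmost column, where its two subtrees
are drawn below and above everything else. -/
theorem ChainDrawable.turn {v w : ℤ} {u u' : Unit} {l rl rr : BinaryTree Unit} (hv : 0 ≤ v)
    (hvw : 2 * v ≤ w) (hl : SideDrawable l v l.numNodes) (hrl : RightSpine (w + 1) rl)
    (hrr : LeftSpine w rr) : ChainDrawable v w (.node u l (.node u' rl rr)) := by
  refine ⟨l.numNodes + 1 + rl.numNodes, rr.numNodes, by omega, by omega, by simp; omega,
    fun y₀ y hy => ?_⟩
  obtain ⟨b, hb1, hb2, Hl⟩ := hl.place_left (by positivity) 0 (y₀ - l.numNodes - 1)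
  rw [zero_add] at Hl
  -- Both spines land in column `w + 1`: `rl` takes all columns from `0`, whereas `rr` needs one
  -- column less and starts at column `1`.
  have H1 := hrl.attachable (by omega) 0 (y₀ - l.numNodes - 1 - rl.numNodes)
  have H2 := hrr.attachable (by omega) 1 y
  have H1' : Attachable rl (w + 1) b 0 (-1) (fun a c =>
      Box 0 (w + 2) (y₀ - l.numNodes - 1 - rl.numNodes) (y₀ - l.numNodes - 1) a c ∨
      (a = w + 1 ∧ y₀ - l.numNodes - 1 ≤ c ∧ c < b)) :=
    H1.extend _ _ (b - (y₀ - l.numNodes - 1)) (by omega) (by ring) (by ring)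
      (fun a c => by unfold Box; omega) fun i h1 h2 => by unfold Box; omega
  have H2' : Attachable rr (w + 1) b 0 1 (fun a c =>
      Box 0 (w + 2) y (y + rr.numNodes) a c ∨ (a = w + 1 ∧ b < c ∧ c < y)) :=
    H2.extend _ _ (y - 1 - b) (by omega) (by ring) (by ring)
      (fun a c => by unfold Box; omega) fun i h1 h2 => by unfold Box; omega
  have Hr : Attachable (.node u' rl rr) v b 1 0 (fun a c =>
      (Box 0 (w + 2) (y₀ - l.numNodes - 1 - rl.numNodes) (y₀ - l.numNodes - 1) a c ∨
      (a = w + 1 ∧ y₀ - l.numNodes - 1 ≤ c ∧ c < b)) ∨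
      (Box 0 (w + 2) y (y + rr.numNodes) a c ∨ (a = w + 1 ∧ b < c ∧ c < y)) ∨
      (c = b ∧ v < a ∧ a ≤ w + 1)) := by
    refine .node H1' H2' (w + 1 - v) (by omega) (by ring) (by ring) (by unfold Turn; omega)
      (fun j h1 h2 => ?_) (fun a b => ?_) (fun a b => ?_) (fun a b => ?_) <;>
      unfold Box <;> omega
  refine .node Hl Hr (y₀ - b) (by omega) (by ring) (by ring) (by unfold Turn; omega)
    (fun j h1 h2 => ?_) (fun a b => ?_) (fun a b => ?_) (fun a b => ?_) <;>
    simp only [ChainRegion, Box] <;> omega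

/-- The root and its small right subtree occupy the gap between the lower and upper parts of the
chain's region, which is why `ChainDrawable` allows an arbitrary gap. The gap has one row more than
`r` has vertices, so that a row exists for the root even if `r` is empty. -/
theorem SideDrawable.of_chain {v w : ℤ} {u : Unit} {l r : BinaryTree Unit} (hv : 0 ≤ v)
    (hvw : 2 * v ≤ w) (hl : ChainDrawable v w l) (hr : SideDrawable r v r.numNodes) :
    SideDrawable (.node u l r) (w + 2) (BinaryTree.node u l r).numNodes := by
  obtain ⟨h, h', h0, h0', hh, H⟩ := hl
  obtain ⟨b, hb1, hb2, Hr⟩ := hr.place_right (by positivity) (v + 1) h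
  rw [add_sub_cancel_right] at Hr
  have Hl : Attachable l v b 0 (-1) (fun a c => ChainRegion w h h (h + r.numNodes + 1) h' a c ∨
      (a = v ∧ h ≤ c ∧ c < b)) :=
    (H h (h + r.numNodes + 1) (by omega)).extend _ _ (b - h) (by omega)
      (by ring) (by ring) (fun a c h => .inl h)
      fun i h1 h2 => by unfold ChainRegion Box; omega
  refine ⟨b, ?_⟩
  simp only [BinaryTree.numNodes, Nat.cast_add, Nat.cast_one]
  refine .node Hl Hr (v + 1) (by omega) (by ring) (by ring) (by unfold Turn; omega)
    (fun j h1 h2 => ?_) (fun a b => ?_) (fun a b => ?_) (fun a b => ?_) <;>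
    simp only [ChainRegion, Box] <;> omega

/-- The chain descends into the subtree with more than `q` vertices and stops at a right child that
is `PureLeft`. Such a child exists because `T` itself is not `PureLeft`. -/
theorem chainDrawable_of_not_pureLeft {m q : ℕ} {v w : ℤ} (hv : 0 ≤ v)
    (hvw : 2 * v ≤ w)
    (hm : ∀ T : BinaryTree Unit, T.numNodes ≤ m → SideDrawable T v T.numNodes)
    (hq : ∀ T : BinaryTree Unit, T.numNodes ≤ q → SideDrawable T w T.numNodes)
    {T : BinaryTree Unit} (hT : T.numNodes ≤ q + m)
    (hp : ¬ PureLeft q T) : ChainDrawable v w T := by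
  induction T with
  | nil => exact absurd trivial hp
  | node u l r ihl ihr =>
    simp only [BinaryTree.numNodes] at hT
    by_cases hr : r.numNodes ≤ q
    · have hl : ¬ PureLeft q l := fun h => hp ⟨hr, h⟩
      have hl' : q < l.numNodes := not_le.1 fun h => hl (.of_numNodes_le h)
      exact .cons_left hv hvw (ihl (by omega) hl) (hm r (by omega))
    · by_cases hr' : PureLeft q r
      · cases r with
        | nil => simp at hr
        | node u' rl rr =>
          refine .turn hv hvw (hm l (by omega)) ?_
            ((PureLeft.of_numNodes_le hr'.1).leftSpine hq)
          have hrl := hr'.2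
          cases rl with
          | nil => trivial
          | node u'' a b =>
            -- The left subtree of `rl` may still exceed `q` vertices, but it is `PureLeft` and so
            -- costs one extra column; this is why `turn` allows width `w + 1` here.
            exact ⟨(hrl.2.leftSpine hq).sideDrawable (by omega),
              rightSpine_of_numNodes_le hrl.1 fun T hT => (hq T hT).mono (by omega) le_rfl⟩
      · exact .cons_right hv hvw (hm l (by omega)) (ihr (by omega) hr')

theorem sideDrawable_node_of_le {m q : ℕ} {v w : ℤ} (hv : 0 ≤ v)
    (hvw : 2 * v ≤ w)
    (hm : ∀ T : BinaryTree Unit, T.numNodes ≤ m → SideDrawable T v T.numNodes)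
    (hq : ∀ T : BinaryTree Unit, T.numNodes ≤ q → SideDrawable T w T.numNodes)
    {u : Unit} {l r : BinaryTree Unit}
    (hT : l.numNodes + r.numNodes + 1 ≤ q + m) (hr : r.numNodes ≤ q) :
    SideDrawable (.node u l r) (w + 2) (BinaryTree.node u l r).numNodes := by
  by_cases hl : PureLeft q l
  · have hp : PureLeft q (.node u l r) := ⟨hr, hl⟩
    exact ((hp.leftSpine hq).sideDrawable (by omega)).mono (by omega) le_rfl
  · have hl' : q < l.numNodes := not_le.1 fun h => hl (.of_numNodes_le h)
    exact .of_chain hv hvw (chainDrawable_of_not_pureLeft hv hvw hm hq (by omega) hl)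
      (hm r (by omega))

/-- The recursion step: if trees with at most `m` vertices have width `v`, and trees with at most
`q` vertices have width `w ≥ 2 * v`, then trees with at most `q + m` vertices have width `w + 2`. -/
theorem sideDrawable_step {m q : ℕ} {v w : ℤ} (hv : 0 ≤ v)
    (hvw : 2 * v ≤ w)
    (hm : ∀ T : BinaryTree Unit, T.numNodes ≤ m → SideDrawable T v T.numNodes)
    (hq : ∀ T : BinaryTree Unit, T.numNodes ≤ q → SideDrawable T w T.numNodes)
    (hmq : m ≤ q) (T : BinaryTree Unit) (hT : T.numNodes ≤ q + m) :
    SideDrawable T (w + 2) T.numNodes := by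
  cases T with
  | nil => exact ⟨0, trivial⟩
  | node u l r =>
    simp only [BinaryTree.numNodes] at hT
    by_cases hr : r.numNodes ≤ q
    · exact sideDrawable_node_of_le hv hvw hm hq hT hr
    -- The right subtree is large, so the left one is small and reflection exchanges their roles.
    · refine .of_mirror ?_
      rw [← numNodes_mirror]
      refine sideDrawable_node_of_le hv hvw hm hq ?_ ?_ <;>
        simp only [numNodes_mirror] <;> omega

/-! ### Iterating the recursion. -/

/-- A bound on the width for trees with at most `2 ^ (k * (k + 1) / 2)` vertices. -/
theorem sideDrawable_of_numNodes_le (k : ℕ) : ∀ T : BinaryTree Unit,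
    T.numNodes ≤ 2 ^ (k * (k + 1) / 2) → SideDrawable T (2 ^ k * (2 * k + 1)) T.numNodes := by
  induction k with
  | zero =>
    intro T hT
    have hp : LeftSpine 0 T := by
      cases T with
      | nil => trivial
      | node u l r =>
        simp at hT
        cases l <;> cases r <;> simp_all
        exact ⟨⟨0, trivial⟩, trivial⟩
    simpa using hp.sideDrawable le_rfl
  | succ k ih =>
    set m := 2 ^ (k * (k + 1) / 2) with hm
    set v : ℤ := 2 ^ k * (2 * k + 1) with hv
    have hv0 : 0 ≤ v := by positivity
    -- Here `m` and `v` stay fixed. The start value `2 * v` is wasteful for `m` vertices but makes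
    -- the step applicable from the outset.
    have key : ∀ j : ℕ, ∀ T : BinaryTree Unit, T.numNodes ≤ (j + 1) * m →
        SideDrawable T (2 * v + 2 * j) T.numNodes := by
      intro j
      induction j with
      | zero =>
        intro T hT
        exact (ih T (by simpa using hT)).mono (by simp; omega) le_rfl
      | succ j ihj =>
        intro T hT
        have := sideDrawable_step (m := m) (q := (j + 1) * m) hv0 (by omega) ih ihj
          (by nlinarith) T (by linarith)
        exact this.mono (by push_cast; omega) le_rfl
    intro T hT
    have hexp : (k + 1) * (k + 1 + 1) / 2 = k * (k + 1) / 2 + (k + 1) := by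
      rw [show (k + 1) * (k + 1 + 1) = k * (k + 1) + 2 * (k + 1) by ring]
      omega
    rw [hexp, pow_add, mul_comm] at hT
    have h1 : 1 ≤ 2 ^ (k + 1) := Nat.one_le_two_pow
    refine (key (2 ^ (k + 1) - 1) T (by rwa [Nat.sub_add_cancel h1])).mono ?_ le_rfl
    -- What remains is `2 * v + 2 * (2 ^ (k + 1) - 1) ≤ 2 ^ (k + 1) * (2 * k + 3)`.
    push_cast [h1]
    rw [hv, pow_succ]
    nlinarith

/-! ### From lattice drawings to planar straight-line drawings. -/

/-- `d` is one of the four axis directions. -/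
def IsAxis (d : ℤ × ℤ) : Prop :=
  (d.1 = 1 ∧ d.2 = 0) ∨ (d.1 = 0 ∧ d.2 = 1) ∨ (d.1 = -1 ∧ d.2 = 0) ∨ (d.1 = 0 ∧ d.2 = -1)

/-- The grid point `j` steps in direction `d` from `o`. -/
def walk (o d : ℤ × ℤ) (j : ℤ) : ℤ × ℤ := (o.1 + j * d.1, o.2 + j * d.2)

/-- Positions `pos` of the vertices of `T`, where the edge to a vertex `p` from its parent starts
at `org p` and goes `len p` steps in direction `dir p`. All edges without their starting points are
disjoint and contained in `S`. -/
structure Layout (T : BinaryTree Unit) (o d : ℤ × ℤ) (S : ℤ → ℤ → Prop)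
    (org pos dir : List Bool → ℤ × ℤ) (len : List Bool → ℤ) : Prop where
  org_nil : org [] = o
  dir_nil : dir [] = d
  org_append : ∀ p b, IsVertex T (p ++ [b]) → org (p ++ [b]) = pos p
  pos_eq : ∀ p, IsVertex T p → pos p = walk (org p) (dir p) (len p)
  one_le : ∀ p, IsVertex T p → 1 ≤ len p
  isAxis : ∀ p, IsVertex T p → IsAxis (dir p)
  mem : ∀ p, IsVertex T p → ∀ j, 1 ≤ j → j ≤ len p →
    S (walk (org p) (dir p) j).1 (walk (org p) (dir p) j).2
  eq_of_walk_eq : ∀ p q, IsVertex T p → IsVertex T q → ∀ i j, 1 ≤ i → i ≤ len p → 1 ≤ j →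
    j ≤ len q → walk (org p) (dir p) i = walk (org q) (dir q) j → p = q
  turn : ∀ p, IsVertex T (p ++ [false]) → IsVertex T (p ++ [true]) →
    Turn (dir p).1 (dir p).2 (dir (p ++ [false])).1 (dir (p ++ [false])).2
      (dir (p ++ [true])).1 (dir (p ++ [true])).2

/-- Combine data for the root, the left subtree, and the right subtree. -/
def combine {α : Type} (a : α) (f g : List Bool → α) : List Bool → α
  | [] => a
  | false :: p => f p
  | true :: p => g p

theorem Attachable.exists_layout {T : BinaryTree Unit} {x y dx dy : ℤ} {S : ℤ → ℤ → Prop}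
    (h : Attachable T x y dx dy S) (hd : IsAxis (dx, dy)) :
    ∃ org pos dir len, Layout T (x, y) (dx, dy) S org pos dir len := by
  induction T generalizing x y dx dy S with
  | nil =>
    exact ⟨fun _ => (x, y), fun _ => 0, fun _ => (dx, dy), fun _ => 0, rfl, rfl,
      fun _ _ h => h.elim, fun _ h => h.elim, fun _ h => h.elim, fun _ h => h.elim,
      fun _ h => h.elim, fun _ _ h => h.elim, fun _ h => h.elim⟩
  | node u l r ihl ihr =>
    obtain ⟨k, lx, ly, rx, ry, L, R, hk, ht, hs, hL, hR, hLR, hl, hr⟩ := h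
    obtain ⟨o₁, p₁, d₁, n₁, H₁⟩ := ihl hl (by unfold IsAxis Turn at *; simp only at *; omega)
    obtain ⟨o₂, p₂, d₂, n₂, H₂⟩ := ihr hr (by unfold IsAxis Turn at *; simp only at *; omega)
    refine ⟨combine (x, y) o₁ o₂, combine (x + k * dx, y + k * dy) p₁ p₂,
      combine (dx, dy) d₁ d₂, combine k n₁ n₂, rfl, rfl, ?_, ?_, ?_, ?_, ?_, ?_, ?_⟩
    · rintro (_ | ⟨_ | _, p⟩) b hp
      · cases b
        · exact H₁.org_nil
        · exact H₂.org_nil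
      · exact H₁.org_append p b hp
      · exact H₂.org_append p b hp
    · rintro (_ | ⟨_ | _, p⟩) hp
      · rfl
      · exact H₁.pos_eq p hp
      · exact H₂.pos_eq p hp
    · rintro (_ | ⟨_ | _, p⟩) hp
      · exact hk
      · exact H₁.one_le p hp
      · exact H₂.one_le p hp
    · rintro (_ | ⟨_ | _, p⟩) hp
      · exact hd
      · exact H₁.isAxis p hp
      · exact H₂.isAxis p hp
    · rintro (_ | ⟨_ | _, p⟩) hp j h1 h2
      · exact (hs j h1 h2).1
      · exact hL _ _ (H₁.mem p hp j h1 h2)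
      · exact hR _ _ (H₂.mem p hp j h1 h2)
    · rintro (_ | ⟨_ | _, p⟩) (_ | ⟨_ | _, q⟩) hp hq i j hi hi' hj hj' h
      · rfl
      · have := H₁.mem q hq j hj hj'
        change walk (x, y) (dx, dy) i = walk (o₁ q) (d₁ q) j at h
        rw [← h] at this
        exact absurd this (hs i hi hi').2.1
      · have := H₂.mem q hq j hj hj'
        change walk (x, y) (dx, dy) i = walk (o₂ q) (d₂ q) j at h
        rw [← h] at this
        exact absurd this (hs i hi hi').2.2
      · have := H₁.mem p hp i hi hi'
        change walk (o₁ p) (d₁ p) i = walk (x, y) (dx, dy) j at h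
        rw [h] at this
        exact absurd this (hs j hj hj').2.1
      · rw [H₁.eq_of_walk_eq p q hp hq i j hi hi' hj hj' h]
      · have h1 := H₁.mem p hp i hi hi'
        have h2 := H₂.mem q hq j hj hj'
        change walk (o₁ p) (d₁ p) i = walk (o₂ q) (d₂ q) j at h
        rw [← h] at h2
        exact absurd h2 (hLR _ _ h1)
      · have := H₂.mem p hp i hi hi'
        change walk (o₂ p) (d₂ p) i = walk (x, y) (dx, dy) j at h
        rw [h] at this
        exact absurd this (hs j hj hj').2.2
      · have h1 := H₂.mem p hp i hi hi'
        have h2 := H₁.mem q hq j hj hj'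
        change walk (o₂ p) (d₂ p) i = walk (o₁ q) (d₁ q) j at h
        rw [← h] at h2
        exact absurd h1 (hLR _ _ h2)
      · rw [H₂.eq_of_walk_eq p q hp hq i j hi hi' hj hj' h]
    · rintro (_ | ⟨_ | _, p⟩) hp hq
      · show Turn dx dy (d₁ []).1 (d₁ []).2 (d₂ []).1 (d₂ []).2
        rw [H₁.dir_nil, H₂.dir_nil]
        exact ht
      · exact H₁.turn p hp hq
      · exact H₂.turn p hp hq

theorem mem_openEdge_walk {o d : ℤ × ℤ} {k : ℤ} (hk : 1 ≤ k) {z : ℝ × ℝ}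
    (hz : z ∈ openEdge o (walk o d k)) :
    ∃ s : ℝ, 0 < s ∧ s < k ∧ z.1 = o.1 + s * d.1 ∧ z.2 = o.2 + s * d.2 := by
  obtain ⟨a, b, ha, hb, hab, rfl⟩ := hz
  have hk' : (1 : ℝ) ≤ k := by exact_mod_cast hk
  refine ⟨b * k, by positivity, by nlinarith, ?_, ?_⟩ <;> simp [toPlane, walk]
  · linear_combination (o.1 : ℝ) * hab
  · linear_combination (o.2 : ℝ) * hab

/-- Perpendicular edges meet at lattice points, and overlapping parallel edges can be rounded to a
common lattice point. As starting points are omitted, this fails only for opposite edges joining the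
same two neighbouring points: the second alternative. -/
theorem exists_walk_eq {o d o' d' : ℤ × ℤ} {k k' : ℤ} (hd : IsAxis d) (hd' : IsAxis d')
    {s s' : ℝ} (hs : 0 < s) (hsk : s < k) (hs' : 0 < s') (hsk' : s' < k')
    (hx : (o.1 : ℝ) + s * d.1 = o'.1 + s' * d'.1) (hy : (o.2 : ℝ) + s * d.2 = o'.2 + s' * d'.2) :
    (∃ i j, 1 ≤ i ∧ i ≤ k ∧ 1 ≤ j ∧ j ≤ k' ∧ walk o d i = walk o' d' j) ∨
    ((∃ i, 1 ≤ i ∧ i ≤ k ∧ walk o d i = o') ∧ ∃ j, 1 ≤ j ∧ j ≤ k' ∧ walk o' d' j = o) := by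
  obtain ⟨x, y⟩ := o
  obtain ⟨a, b⟩ := d
  obtain ⟨x', y'⟩ := o'
  obtain ⟨a', b'⟩ := d'
  simp only [IsAxis, walk, Prod.mk.injEq] at *
  have haa : a * a + b * b = 1 := by rcases hd with h | h | h | h <;> simp [h]
  have haa' : a' * a' + b' * b' = 1 := by rcases hd' with h | h | h | h <;> simp [h]
  have haaR : (a : ℝ) * a + b * b = 1 := by exact_mod_cast haa
  have haaR' : (a' : ℝ) * a' + b' * b' = 1 := by exact_mod_cast haa'
  have hcase : a * a' + b * b' = 0 ∨ (a' = a ∧ b' = b) ∨ (a' = -a ∧ b' = -b) := by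
    rcases hd with h | h | h | h <;> rcases hd' with h' | h' | h' | h' <;> simp [h, h']
  rcases hcase with hp | ⟨rfl, rfl⟩ | ⟨rfl, rfl⟩
  · have hpR : (a : ℝ) * a' + b * b' = 0 := by exact_mod_cast hp
    have h1 : s = ((a * (x' - x) + b * (y' - y) : ℤ) : ℝ) := by
      push_cast
      linear_combination (-s) * haaR + (a : ℝ) * hx + (b : ℝ) * hy + s' * hpR
    have h2 : s' = ((a' * (x - x') + b' * (y - y') : ℤ) : ℝ) := by
      push_cast
      linear_combination (-s') * haaR' - (a' : ℝ) * hx - (b' : ℝ) * hy + s * hpR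
    generalize a * (x' - x) + b * (y' - y) = i at h1
    generalize a' * (x - x') + b' * (y - y') = j at h2
    subst h1 h2
    norm_cast at *
    exact .inl ⟨i, j, by omega, by omega, by omega, by omega, hx, hy⟩
  · have h1 : s - s' = ((a' * (x' - x) + b' * (y' - y) : ℤ) : ℝ) := by
      push_cast
      linear_combination (-s + s') * haaR + (a' : ℝ) * hx + (b' : ℝ) * hy
    generalize a' * (x' - x) + b' * (y' - y) = n at h1
    obtain rfl : s = s' + n := by linarith
    have hx' : x + n * a' = x' := by
      have : (x : ℝ) + n * a' = x' := by linarith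
      exact_mod_cast this
    have hy' : y + n * b' = y' := by
      have : (y : ℝ) + n * b' = y' := by linarith
      exact_mod_cast this
    -- The parameters differ by the integer `n`, so both round up to the same lattice point.
    refine .inl ⟨⌈s'⌉ + n, ⌈s'⌉, ?_, ?_, Int.one_le_ceil_iff.2 hs', Int.ceil_le.2 hsk'.le,
      by rw [← hx']; ring, by rw [← hy']; ring⟩
    · rw [← Int.ceil_add_intCast]
      exact Int.one_le_ceil_iff.2 hs
    · rw [← Int.ceil_add_intCast]
      exact Int.ceil_le.2 hsk.le
  · push_cast at hx hy
    have h1 : s + s' = ((a * (x' - x) + b * (y' - y) : ℤ) : ℝ) := by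
      push_cast
      linear_combination (-s - s') * haaR + (a : ℝ) * hx + (b : ℝ) * hy
    generalize a * (x' - x) + b * (y' - y) = n at h1
    obtain rfl : s' = n - s := by linarith
    have hx' : x + n * a = x' := by
      have : (x : ℝ) + n * a = x' := by linarith
      exact_mod_cast this
    have hy' : y + n * b = y' := by
      have : (y : ℝ) + n * b = y' := by linarith
      exact_mod_cast this
    have hn : ⌈s⌉ ≤ n := Int.ceil_le.2 (by linarith)
    have hi : 1 ≤ ⌈s⌉ := Int.one_le_ceil_iff.2 hs
    have hik : ⌈s⌉ ≤ k := Int.ceil_le.2 hsk.le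
    have hjk : n - ⌈s⌉ < k' := by
      have := Int.le_ceil s
      have h3 : ((n - ⌈s⌉ : ℤ) : ℝ) < k' := by push_cast; linarith
      exact_mod_cast h3
    rcases hn.lt_or_eq with hn | hn
    · exact .inl ⟨⌈s⌉, n - ⌈s⌉, hi, hik, by omega, by omega,
        by rw [← hx']; ring, by rw [← hy']; ring⟩
    have hk' : 1 ≤ k' := by
      have h3 : (0 : ℝ) < k' := by linarith
      exact_mod_cast h3
    rcases hi.lt_or_eq with hi | hi
    · exact .inl ⟨n - 1, 1, by omega, by omega, le_rfl, hk',
        by rw [← hx']; ring, by rw [← hy']; ring⟩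
    · obtain rfl : n = 1 := by omega
      exact .inr ⟨⟨1, le_rfl, by omega, hx', hy'⟩, 1, le_rfl, hk',
        by rw [← hx']; ring, by rw [← hy']; ring⟩

theorem Layout.isPlanar {T : BinaryTree Unit} {o d : ℤ × ℤ} {S : ℤ → ℤ → Prop}
    {org pos dir : List Bool → ℤ × ℤ} {len : List Bool → ℤ}
    (H : Layout T o d S org pos dir len) : IsPlanar T pos := by
  have edge : ∀ {p q}, IsEdge T p q → ∀ {z}, z ∈ openEdge (pos p) (pos q) → ∃ s : ℝ, 0 < s ∧
      s < len q ∧ z.1 = (org q).1 + s * (dir q).1 ∧ z.2 = (org q).2 + s * (dir q).2 := by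
    rintro p _ ⟨hp, hq, b, rfl⟩ z hz
    rw [← H.org_append p b hq, H.pos_eq _ hq] at hz
    exact mem_openEdge_walk (H.one_le _ hq) hz
  refine ⟨fun p hp q hq h => ?_, fun p q v hpq hv hz => ?_, fun p q p' q' h h' hne => ?_⟩
  · rw [H.pos_eq p hp, H.pos_eq q hq] at h
    exact H.eq_of_walk_eq p q hp hq _ _ (H.one_le p hp) le_rfl (H.one_le q hq) le_rfl h
  · obtain ⟨s, hs, hs', hx, hy⟩ := edge hpq hz
    have hq := hpq.2.1
    have hax := H.isAxis q hq
    obtain ⟨i, rfl⟩ : ∃ i : ℤ, (i : ℝ) = s := by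
      simp only [toPlane] at hx hy
      rcases hax with h | h | h | h <;> simp only [h] at hx hy
      · exact ⟨(pos v).1 - (org q).1, by push_cast at *; linarith⟩
      · exact ⟨(pos v).2 - (org q).2, by push_cast at *; linarith⟩
      · exact ⟨(org q).1 - (pos v).1, by push_cast at *; linarith⟩
      · exact ⟨(org q).2 - (pos v).2, by push_cast at *; linarith⟩
    simp only [toPlane] at hx hy
    norm_cast at hs hs' hx hy
    have hvi : pos v = walk (org q) (dir q) i := Prod.ext hx hy
    have hlen := H.one_le v hv
    have hvq : v = q := H.eq_of_walk_eq v q hv hq (len v) i hlen le_rfl (by omega) hs'.le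
      ((H.pos_eq v hv).symm.trans hvi)
    subst hvq
    rw [H.pos_eq v hv] at hvi
    have h1 := congrArg Prod.fst hvi
    have h2 := congrArg Prod.snd hvi
    simp only [walk] at h1 h2
    rcases hax with h | h | h | h <;> simp only [h] at h1 h2 <;> omega
  · rw [Set.disjoint_left]
    intro z hz hz'
    obtain ⟨s, hs, hsk, hx, hy⟩ := edge h hz
    obtain ⟨s', hs', hsk', hx', hy'⟩ := edge h' hz'
    obtain ⟨hp, hq, b, rfl⟩ := h
    obtain ⟨hp', hq', b', rfl⟩ := h'
    rcases exists_walk_eq (H.isAxis _ hq) (H.isAxis _ hq') hs hsk hs' hsk' (hx ▸ hx') (hy ▸ hy')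
      with ⟨i, j, hi, hi', hj, hj', hij⟩ | ⟨⟨i, hi, hi', hi''⟩, ⟨j, hj, hj', hj''⟩⟩
    · have := H.eq_of_walk_eq _ _ hq hq' i j hi hi' hj hj' hij
      have := List.append_inj' this rfl
      simp_all
    -- Each edge would end at the parent vertex of the other, which is impossible by the lengths of
    -- the addresses.
    · rw [H.org_append _ _ hq', H.pos_eq _ hp'] at hi''
      rw [H.org_append _ _ hq, H.pos_eq _ hp] at hj''
      have h1 := H.eq_of_walk_eq _ _ hq hp' _ _ hi hi' (H.one_le _ hp') le_rfl hi''
      have h2 := H.eq_of_walk_eq _ _ hq' hp _ _ hj hj' (H.one_le _ hp) le_rfl hj''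
      have h1 := congrArg List.length h1
      have h2 := congrArg List.length h2
      simp at h1 h2
      omega

theorem Layout.isOrthogonal {T : BinaryTree Unit} {o d : ℤ × ℤ} {S : ℤ → ℤ → Prop}
    {org pos dir : List Bool → ℤ × ℤ} {len : List Bool → ℤ}
    (H : Layout T o d S org pos dir len) : IsOrthogonal T pos := by
  rintro p _ ⟨hp, hq, b, rfl⟩
  rw [H.pos_eq _ hq, H.org_append _ _ hq]
  have := H.isAxis _ hq
  unfold IsAxis at this
  rcases this with h | h | h | h <;> simp [walk, h]

theorem IsAxis.exists_angle {d : ℤ × ℤ} (hd : IsAxis d) :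
    ∃ θ : ℝ, Real.cos θ = d.1 ∧ Real.sin θ = d.2 := by
  rcases hd with h | h | h | h
  · exact ⟨0, by simp [h], by simp [h]⟩
  · exact ⟨Real.pi / 2, by simp [h], by simp [h]⟩
  · exact ⟨Real.pi, by simp [h], by simp [h]⟩
  · exact ⟨-(Real.pi / 2), by simp [h], by simp [h]⟩

theorem hasDirection_walk {o d : ℤ × ℤ} {k : ℤ} {θ : ℝ} (hk : 1 ≤ k) (hc : Real.cos θ = d.1)
    (hs : Real.sin θ = d.2) : HasDirection o (walk o d k) θ :=
  ⟨k, by exact_mod_cast hk, by simp [toPlane, walk, hc, hs]⟩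

theorem Layout.isOrderPreserving {T : BinaryTree Unit} {o d : ℤ × ℤ} {S : ℤ → ℤ → Prop}
    {org pos dir : List Bool → ℤ × ℤ} {len : List Bool → ℤ}
    (H : Layout T o d S org pos dir len) : IsOrderPreserving T pos := by
  rintro u _ ⟨hu, hv, b, rfl⟩ hl hr
  set v := u ++ [b]
  obtain ⟨θ, hc, hs⟩ := (H.isAxis _ hv).exists_angle
  have hpar : HasDirection (pos v) (pos u) (θ + Real.pi) := by
    refine ⟨len v, by exact_mod_cast H.one_le _ hv, ?_⟩
    rw [H.pos_eq v hv, H.org_append _ _ hv]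
    simp [toPlane, walk, hc, hs]
  have hleft : ∀ {β : ℝ}, Real.cos β = (dir (v ++ [false])).1 →
      Real.sin β = (dir (v ++ [false])).2 → HasDirection (pos v) (pos (v ++ [false])) β := by
    intro β h1 h2
    rw [H.pos_eq _ hl, H.org_append _ _ hl]
    exact hasDirection_walk (H.one_le _ hl) h1 h2
  have hright : ∀ {β : ℝ}, Real.cos β = (dir (v ++ [true])).1 →
      Real.sin β = (dir (v ++ [true])).2 → HasDirection (pos v) (pos (v ++ [true])) β := by
    intro β h1 h2
    rw [H.pos_eq _ hr, H.org_append _ _ hr]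
    exact hasDirection_walk (H.one_le _ hr) h1 h2
  have hpi := Real.pi_pos
  -- Seen from `v`, the parent lies at angle `θ + π`; turning clockwise, going straight and turning
  -- counterclockwise are represented by `θ + 3π/2`, `θ + 2π` and `θ + 5π/2`, so that the angles
  -- increase within one full turn.
  have c1 : Real.cos (θ + 3 * Real.pi / 2) = Real.sin θ := by
    rw [show θ + 3 * Real.pi / 2 = θ - Real.pi / 2 + 2 * Real.pi by ring, Real.cos_add_two_pi,
      Real.cos_sub_pi_div_two]
  have s1 : Real.sin (θ + 3 * Real.pi / 2) = -Real.cos θ := by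
    rw [show θ + 3 * Real.pi / 2 = θ - Real.pi / 2 + 2 * Real.pi by ring, Real.sin_add_two_pi,
      Real.sin_sub_pi_div_two]
  have c3 : Real.cos (θ + 5 * Real.pi / 2) = -Real.sin θ := by
    rw [show θ + 5 * Real.pi / 2 = θ + Real.pi / 2 + 2 * Real.pi by ring, Real.cos_add_two_pi,
      Real.cos_add_pi_div_two]
  have s3 : Real.sin (θ + 5 * Real.pi / 2) = Real.cos θ := by
    rw [show θ + 5 * Real.pi / 2 = θ + Real.pi / 2 + 2 * Real.pi by ring, Real.sin_add_two_pi,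
      Real.sin_add_pi_div_two]
  rcases H.turn v hl hr with ⟨h1, h2, h3, h4⟩ | ⟨h1, h2, h3, h4⟩ | ⟨h1, h2, h3, h4⟩
  · exact ⟨θ + Real.pi, θ + 3 * Real.pi / 2, θ + 2 * Real.pi, by linarith, by linarith, by linarith,
      hpar, hleft (by simp [c1, h1, hs]) (by simp [s1, h2, hc]), hright (by simp [h3, hc])
      (by simp [h4, hs])⟩
  · exact ⟨θ + Real.pi, θ + 3 * Real.pi / 2, θ + 5 * Real.pi / 2, by linarith, by linarith,
      by linarith, hpar, hleft (by simp [c1, h1, hs]) (by simp [s1, h2, hc]),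
      hright (by simp [c3, h3, hs]) (by simp [s3, h4, hc])⟩
  · exact ⟨θ + Real.pi, θ + 2 * Real.pi, θ + 5 * Real.pi / 2, by linarith, by linarith,
      by linarith, hpar, hleft (by simp [h1, hc]) (by simp [h2, hs]),
      hright (by simp [c3, h3, hs]) (by simp [s3, h4, hc])⟩

theorem SideDrawable.exists_drawing {T : BinaryTree Unit} {W H : ℕ} (h : SideDrawable T W H) :
    ∃ pos, InGrid T pos W H ∧ IsPlanar T pos ∧ IsOrthogonal T pos ∧ IsOrderPreserving T pos := by
  obtain ⟨y, h⟩ := h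
  obtain ⟨org, pos, dir, len, hL⟩ := (h.translate 1 1).exists_layout (.inl ⟨rfl, rfl⟩)
  refine ⟨pos, fun p hp => ?_, hL.isPlanar, hL.isOrthogonal, hL.isOrderPreserving⟩
  have := hL.mem p hp (len p) (hL.one_le p hp) le_rfl
  rw [← hL.pos_eq p hp] at this
  simp only [Box] at this
  simp only [Set.mem_prod, Set.mem_Icc]
  omega

/-! ### The numerical estimate and the conclusion. -/

theorem exists_width_bound {n : ℕ} (hn : 2 ≤ n) : ∃ k : ℕ, n ≤ 2 ^ (k * (k + 1) / 2) ∧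
    (2 : ℝ) ^ k * (2 * k + 1) ≤
      14 * ((2 : ℝ) ^ Real.sqrt (2 * Real.logb 2 n) * Real.sqrt (Real.logb 2 n)) := by
  have hn' : (2 : ℝ) ≤ n := by exact_mod_cast hn
  set l := Real.logb 2 n with hl
  have hl1 : 1 ≤ l := by
    rw [hl, Real.le_logb_iff_rpow_le (by norm_num) (by linarith)]
    simpa using hn'
  set s := Real.sqrt (2 * l) with hs
  have hs0 : 0 ≤ s := Real.sqrt_nonneg _
  have hss : s * s = 2 * l := Real.mul_self_sqrt (by linarith)
  set r := Real.sqrt l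
  have hr0 : 0 ≤ r := Real.sqrt_nonneg _
  have hrr : r * r = l := Real.mul_self_sqrt (by linarith)
  have hr1 : 1 ≤ r := by nlinarith
  have hsr : s ≤ 2 * r := by nlinarith
  have hks := Nat.le_ceil s
  have hks' := (Nat.ceil_lt_add_one hs0).le
  set k := ⌈s⌉₊
  refine ⟨k, ?_, ?_⟩
  · have hdiv : ((k * (k + 1) / 2 : ℕ) : ℝ) = k * (k + 1) / 2 := by
      rw [Nat.cast_div (Nat.even_mul_succ_self k).two_dvd (by norm_num)]
      push_cast
      ring
    have h1 : l ≤ ((k * (k + 1) / 2 : ℕ) : ℝ) := by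
      rw [hdiv]
      nlinarith
    have h2 : (n : ℝ) ≤ (2 : ℝ) ^ (k * (k + 1) / 2) := by
      rw [← Real.rpow_natCast, ← Real.logb_le_iff_le_rpow (by norm_num) (by linarith)]
      exact h1
    exact_mod_cast h2
  · have h1 : (2 : ℝ) ^ k ≤ 2 * (2 : ℝ) ^ s := by
      rw [← Real.rpow_natCast]
      calc (2 : ℝ) ^ (k : ℝ) ≤ 2 ^ (s + 1) :=
            Real.rpow_le_rpow_of_exponent_le (by norm_num) hks'
        _ = 2 * 2 ^ s := by rw [Real.rpow_add_one (by norm_num)]; ring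
    -- Here `2 * k + 1 ≤ 2 * s + 3 ≤ 4 * r + 3 ≤ 7 * r`; together with the factor `2` from rounding
    -- up `s` this gives the constant `14`.
    have h2 : (2 * k + 1 : ℝ) ≤ 7 * r := by linarith
    calc (2 : ℝ) ^ k * (2 * k + 1) ≤ (2 * (2 : ℝ) ^ s) * (7 * r) := by gcongr
      _ = _ := by ring

end TreeDrawing

theorem mainTheorem7 :
    ∃ C : ℝ, 0 < C ∧ ∀ n : ℕ, 2 ≤ n → ∀ T : BinaryTree Unit, T.numNodes = n →
      ∃ (pos : List Bool → ℤ × ℤ) (W H : ℕ),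
        TreeDrawing.InGrid T pos W H ∧
        TreeDrawing.IsPlanar T pos ∧
        TreeDrawing.IsOrthogonal T pos ∧
        TreeDrawing.IsOrderPreserving T pos ∧
        (W : ℝ) * (H : ℝ) ≤
          C * ((n : ℝ) * (2 : ℝ) ^ Real.sqrt (2 * Real.logb 2 n) * Real.sqrt (Real.logb 2 n)) := by
  refine ⟨14, by norm_num, fun n hn T hT => ?_⟩
  obtain ⟨k, hk, hW⟩ := TreeDrawing.exists_width_bound hn
  have h := TreeDrawing.sideDrawable_of_numNodes_le k T (hT ▸ hk)
  obtain ⟨pos, h1, h2, h3, h4⟩ := TreeDrawing.SideDrawable.exists_drawing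
    (W := 2 ^ k * (2 * k + 1)) (H := T.numNodes) (by push_cast; exact h)
  refine ⟨pos, _, _, h1, h2, h3, h4, ?_⟩
  rw [hT]
  push_cast
  calc (2 : ℝ) ^ k * (2 * k + 1) * n ≤ _ := mul_le_mul_of_nonneg_right hW (by positivity)
    _ = _ := by ring
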